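/- Let $G=(V,E)$ be a finite simple connected graph with shortest-path distance $d_G$ (also written $d$). For vertices $u,v$ let $I(u,v)=\{w\in V: d(u,v)=d(u,w)+d(w,v)\}$. For real numbers $\lambda,\mu\ge 0$, the graph $G$ satisfies the $(\lambda,\mu)$-bow metric if for all vertices $u,v,w,x$ with $v\in I(u,w)$, $w\in I(v,x)$ and $d(v,w)>\lambda$ one has $d(u,x)\ge d(u,v)+d(v,w)+d(w,x)-\mu$. The graph is $\alpha_i$-metric if for all vertices $u,v,w,x$ with $vw$ an edge, $v\in I(u,w)$ and $w\in I(v,x)$ one has $d(u,x)\ge d(u,v)+d(v,x)-i$. The graph is $\delta$-hyperbolic if for all vertices $u,v,w,x$ the two larger of the three sums $d(u,v)+d(w,x)$, $d(u,w)+d(v,x)$, $d(u,x)+d(v,w)$ differ by at most $2\delta$. The line graph $L(G)$ has the edges of $G$ as its vertices, two distinct edges being adjacent when they share an endpoint. **Corollary.** Let $\mu\ge 0$ be a real number and let $G$ be a finite simple connected bipartite graph satisfying the $(1,\mu)$-bow metric. Then the line graph $L(G)$ is $\alpha_{\mu+2}$-metric, and $G$ is $\delta$-hyperbolic for some $\delta\le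 \frac{3(\mu+1)}{2}+4$. -/

import Mathlib

namespace BowMetric

variable {V : Type*}

/-- The interval `I_G(u, v)`: all vertices lying on a shortest path from `u` to `v`. -/
def interval (G : SimpleGraph V) (u v : V) : Set V :=
  {w | G.dist u v = G.dist u w + G.dist w v}

/-- The `(lam, mu)`-bow metric condition: for all vertices `u, v, w, x`, if `v ∈ I(u, w)`,
`w ∈ I(v, x)` and `d(v, w) > lam`, then `d(u, x) ≥ d(u, v) + d(v, w) + d(w, x) - mu`. -/
def SatisfiesBow (G : SimpleGraph V) (lam mu : ℝ) : Prop :=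
  ∀ u v w x : V, v ∈ interval G u w → w ∈ interval G v x → lam < (G.dist v w : ℝ) →
    (G.dist u v : ℝ) + G.dist v w + G.dist w x - mu ≤ G.dist u x

/-- `G` is an `α_i`-metric graph: whenever a shortest path from `u` to `w` and a shortest path
from `v` to `x` share the terminal edge `vw`, one has `d(u, x) ≥ d(u, v) + d(v, x) - i`. -/
def IsAlphaMetric (G : SimpleGraph V) (i : ℝ) : Prop :=
  ∀ u v w x : V, G.Adj v w → v ∈ interval G u w → w ∈ interval G v x →
    (G.dist u v : ℝ) + G.dist v x - i ≤ G.dist u x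

/-- The four-point condition: for all `u, v, w, x` the two larger of the sums
`d(u, v) + d(w, x)`, `d(u, w) + d(v, x)`, `d(u, x) + d(v, w)` differ by at most `2 * δ`.
Since all four vertices vary, it is enough to say that the first sum exceeds the maximum
of the other two by at most `2 * δ`. -/
def IsHyperbolic (G : SimpleGraph V) (δ : ℝ) : Prop :=
  ∀ u v w x : V, (G.dist u v : ℝ) + G.dist w x ≤
    max ((G.dist u w : ℝ) + G.dist v x) ((G.dist u x : ℝ) + G.dist v w) + 2 * δ

end BowMetric

/-!
Let `G` be connected and bipartite with the `(1, μ)`-bow metric. Adjacent vertices have distances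
to any third vertex that differ by exactly one, so the shortest overlap to which the bow condition
applies is a path `y, z, z'` of length two: if distances from `a` increase along it and distances
from `w` decrease along it, then `d(a, z) + d(z, w) ≤ d(a, w) + μ`
(`SatisfiesBow.dist_add_dist_le`).

*The line graph.* The distance in `L(G)` of two different edges is one more than the least distance
of their endpoints. Let `e₀, e₁, e₂, e₃` be as in the `α`-condition with `e₁ = qp` and `e₂ = pr`, let
`a` be the endpoint of `e₀` that is nearest to `e₁` and `c` the endpoint of `e₃` nearest to `e₂`.
The hypotheses on the distances in `L(G)` and the parity force the distances from `a` to increase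
along `q, p, r` and those from `c` to decrease, and the inequality above is what is needed.

*Hyperbolicity.* Let `z` lie on a shortest path from `u` to `v`, and let `w` be any vertex. Then
`z` is within additive error `μ + 2` of a shortest path from `w` to `u`, or of one from `w` to `v`
(`dist_add_dist_le_or_of_mem_interval`). Indeed, if both neighbours of `z` on the path are farther
from `w` than `z` is, then a neighbour `z'` of `z` that is nearer to `w` cannot be nearer to both `u`
and `v`, so that two steps through `z` to `z'`, starting from one of the neighbours on the path,
form an overlap to which the inequality applies; the other cases are similar.
Given a fourth vertex `x`, move `z` from `u` to `v` along a shortest path. At some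
moment `w` is close to one alternative and `x` is close to the opposite one, up to a single step, and
adding the two estimates gives the four-point condition with `δ = μ + 3`.
-/

namespace BowMetric

/-! ### Distances in connected bipartite graphs -/

section Bipartite

variable {V : Type*} {G : SimpleGraph V}

/-- The length of a walk in a bipartite graph is determined modulo two by its ends, so moving one
end across an edge changes the distance. -/
lemma dist_eq_add_one_or_of_adj (hconn : G.Connected) (hbip : G.IsBipartite) (u : V) {y z : V}
    (h : G.Adj y z) : G.dist u z = G.dist u y + 1 ∨ G.dist u y = G.dist u z + 1 := by
  obtain ⟨c⟩ : G.Colorable (Fintype.card Bool) := hbip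
  let c' : G.Coloring Bool := SimpleGraph.Colorable.toColoring ⟨c⟩ le_rfl
  obtain ⟨p, hp⟩ := hconn.exists_walk_length_eq_dist u y
  obtain ⟨q, hq⟩ := hconn.exists_walk_length_eq_dist u z
  have h1 := c'.even_length_iff_congr p
  have h2 := c'.even_length_iff_congr q
  have h3 : c' y ≠ c' z := c'.valid h
  rw [hp] at h1
  rw [hq] at h2
  have hne : G.dist u y ≠ G.dist u z := by
    intro he
    rw [he] at h1
    revert h1 h2 h3
    cases c' u <;> cases c' y <;> cases c' z <;> simp
  have h4 := hconn.dist_triangle (u := u) (v := y) (w := z)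
  have h5 := hconn.dist_triangle (u := u) (v := z) (w := y)
  rw [SimpleGraph.dist_eq_one_iff_adj.2 h] at h4
  rw [SimpleGraph.dist_eq_one_iff_adj.2 h.symm] at h5
  omega

lemma exists_adj_dist_eq_add_one (hconn : G.Connected) {u z : V} (h : z ≠ u) :
    ∃ y, G.Adj y z ∧ G.dist u z = G.dist u y + 1 := by
  obtain ⟨p, hp⟩ := hconn.exists_walk_length_eq_dist z u
  cases p with
  | nil => exact absurd rfl h
  | @cons _ y _ hadj p =>
    refine ⟨y, hadj.symm, ?_⟩
    have h1 := SimpleGraph.dist_le p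
    have h2 := hconn.dist_triangle (u := z) (v := y) (w := u)
    rw [SimpleGraph.dist_eq_one_iff_adj.2 hadj] at h2
    rw [SimpleGraph.Walk.length_cons] at hp
    rw [SimpleGraph.dist_comm (u := u), SimpleGraph.dist_comm (u := u)]
    omega

/-- The bow condition for an overlap `y, z, z'` of length two, with outer vertices `a` and `w`. -/
lemma SatisfiesBow.dist_add_dist_le {μ : ℝ} (hconn : G.Connected) (hbow : SatisfiesBow G 1 μ)
    {a w y z z' : V} (hyz : G.Adj y z) (hzz' : G.Adj z z')
    (ha : G.dist a z = G.dist a y + 1) (ha' : G.dist a z' = G.dist a z + 1)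
    (hw : G.dist w y = G.dist w z + 1) (hw' : G.dist w z = G.dist w z' + 1) :
    (G.dist a z : ℝ) + G.dist w z ≤ G.dist a w + μ := by
  have h1 := hconn.dist_triangle (u := y) (v := z) (w := z')
  have h2 := hconn.dist_triangle (u := a) (v := y) (w := z')
  rw [SimpleGraph.dist_eq_one_iff_adj.2 hyz, SimpleGraph.dist_eq_one_iff_adj.2 hzz'] at h1
  have h3 : G.dist y z' = 2 := by omega
  have h4 : y ∈ interval G a z' := by
    simp only [interval, Set.mem_ofPred_eq]; omega
  have h5 : z' ∈ interval G y w := by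
    simp only [interval, Set.mem_ofPred_eq]
    rw [SimpleGraph.dist_comm (v := w), SimpleGraph.dist_comm (v := w)]; omega
  have h6 := hbow a y z' w h4 h5 (by rw [h3]; norm_num)
  rw [h3, SimpleGraph.dist_comm (v := w) (u := z')] at h6
  rw [ha] at ha' ⊢
  rw [hw']
  push_cast at h6 ⊢
  linarith

end Bipartite

/-! ### The line graph -/

section LineGraph

variable {V : Type*} {G : SimpleGraph V}

lemma dist_le_one_of_mem_edge (e : G.edgeSet) {a b : V} (ha : a ∈ (e : Sym2 V))
    (hb : b ∈ (e : Sym2 V)) : G.dist a b ≤ 1 := by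
  by_cases hab : a = b
  · simp [hab]
  · have he : (e : Sym2 V) = s(a, b) := (Sym2.mem_and_mem_iff hab).1 ⟨ha, hb⟩
    have h : G.Adj a b := by rw [← SimpleGraph.mem_edgeSet, ← he]; exact e.2
    rw [SimpleGraph.dist_eq_one_iff_adj.2 h]

/-- A walk from `a` to `c`, together with an edge at either end, is a walk of edges. -/
lemma exists_lineGraph_walk {a c : V} (p : G.Walk a c) (e f : G.edgeSet)
    (ha : a ∈ (e : Sym2 V)) (hc : c ∈ (f : Sym2 V)) :
    ∃ q : G.lineGraph.Walk e f, q.length ≤ p.length + 1 := by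
  induction p generalizing e with
  | nil =>
    by_cases hef : e = f
    · subst hef
      exact ⟨.nil, by simp⟩
    · exact ⟨.cons (SimpleGraph.lineGraph_adj_iff_exists.2 ⟨hef, _, ha, hc⟩) .nil, by simp⟩
  | @cons a b c hab p ih =>
    obtain ⟨q, hq⟩ := ih ⟨s(a, b), hab⟩ (by simp) hc
    by_cases hef : e = ⟨s(a, b), hab⟩
    · subst hef
      exact ⟨q, by rw [SimpleGraph.Walk.length_cons]; omega⟩
    · refine ⟨.cons (SimpleGraph.lineGraph_adj_iff_exists.2 ⟨hef, a, ha, by simp⟩) q, ?_⟩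
      rw [SimpleGraph.Walk.length_cons, SimpleGraph.Walk.length_cons]
      omega

lemma lineGraph_dist_le (hconn : G.Connected) {e f : G.edgeSet} {a c : V}
    (ha : a ∈ (e : Sym2 V)) (hc : c ∈ (f : Sym2 V)) :
    G.lineGraph.dist e f ≤ G.dist a c + 1 := by
  obtain ⟨p, hp⟩ := hconn.exists_walk_length_eq_dist a c
  obtain ⟨q, hq⟩ := exists_lineGraph_walk p e f ha hc
  have := SimpleGraph.dist_le q
  omega

lemma exists_dist_add_one_le_of_lineGraph_walk (hconn : G.Connected) {e f : G.edgeSet}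
    (q : G.lineGraph.Walk e f) (hef : e ≠ f) :
    ∃ a ∈ (e : Sym2 V), ∃ c ∈ (f : Sym2 V), G.dist a c + 1 ≤ q.length := by
  induction q with
  | nil => exact absurd rfl hef
  | @cons e g f heg q ih =>
    obtain ⟨-, b, hbe, hbg⟩ := SimpleGraph.lineGraph_adj_iff_exists.1 heg
    rw [SimpleGraph.Walk.length_cons]
    by_cases hgf : g = f
    · subst hgf
      exact ⟨b, hbe, b, hbg, by simp⟩
    · obtain ⟨a, hag, c, hc, h⟩ := ih hgf
      refine ⟨b, hbe, c, hc, ?_⟩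
      have h1 := hconn.dist_triangle (u := b) (v := a) (w := c)
      have h2 := dist_le_one_of_mem_edge g hbg hag
      omega

/-- The distance in the line graph of two different edges is attained by a pair of endpoints. -/
lemma exists_lineGraph_dist_eq (hconn : G.Connected) {e f : G.edgeSet} (hef : e ≠ f) :
    ∃ a ∈ (e : Sym2 V), ∃ c ∈ (f : Sym2 V), G.lineGraph.dist e f = G.dist a c + 1 := by
  have hr : G.lineGraph.Reachable e f := by
    obtain ⟨p⟩ := hconn.preconnected (e : Sym2 V).out.1 (f : Sym2 V).out.1
    obtain ⟨q, -⟩ := exists_lineGraph_walk p e f (Sym2.out_fst_mem _) (Sym2.out_fst_mem _)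
    exact ⟨q⟩
  obtain ⟨q, hq⟩ := hr.exists_walk_length_eq_dist
  obtain ⟨a, ha, c, hc, h⟩ := exists_dist_add_one_le_of_lineGraph_walk hconn q hef
  exact ⟨a, ha, c, hc, le_antisymm (lineGraph_dist_le hconn ha hc) (hq ▸ h)⟩

/-- Moving on from `e₁` to an adjacent edge `e₂` that is farther from `e₀` in the line graph
amounts to a path `q, p, r` in `G` along which the distance from an endpoint of `e₀` increases. -/
lemma exists_dist_increasing_of_lineGraph (hconn : G.Connected) (hbip : G.IsBipartite)
    {e₀ e₁ e₂ : G.edgeSet} {q p r : V} (hqp : G.Adj q p) (hpr : G.Adj p r)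
    (h₁ : (e₁ : Sym2 V) = s(q, p)) (h₂ : (e₂ : Sym2 V) = s(p, r)) (h01 : e₀ ≠ e₁)
    (h : G.lineGraph.dist e₀ e₂ = G.lineGraph.dist e₀ e₁ + 1) :
    ∃ a ∈ (e₀ : Sym2 V), G.lineGraph.dist e₀ e₁ = G.dist a p ∧
      G.dist a p = G.dist a q + 1 ∧ G.dist a r = G.dist a p + 1 := by
  obtain ⟨a, ha, q', hq', hd⟩ := exists_lineGraph_dist_eq hconn h01
  have hp := lineGraph_dist_le hconn (c := p) (f := e₂) ha (by simp [h₂])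
  have hr := lineGraph_dist_le hconn (c := r) (f := e₂) ha (by simp [h₂])
  have hparq := dist_eq_add_one_or_of_adj hconn hbip a hqp
  have hparr := dist_eq_add_one_or_of_adj hconn hbip a hpr
  rw [h₁, Sym2.mem_iff] at hq'
  refine ⟨a, ha, ?_⟩
  rcases hq' with rfl | rfl <;> omega

theorem SatisfiesBow.isAlphaMetric_lineGraph (hconn : G.Connected) (hbip : G.IsBipartite) {μ : ℝ}
    (hμ : 0 ≤ μ) (hbow : SatisfiesBow G 1 μ) : IsAlphaMetric G.lineGraph (μ + 2) := by
  intro e₀ e₁ e₂ e₃ hadj h02 h13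
  simp only [interval, Set.mem_ofPred_eq] at h02 h13
  rw [SimpleGraph.dist_eq_one_iff_adj.2 hadj] at h02 h13
  by_cases h01 : e₀ = e₁
  · subst h01
    rw [SimpleGraph.dist_self]
    push_cast
    linarith
  by_cases h23 : e₂ = e₃
  · subst h23
    rw [SimpleGraph.dist_eq_one_iff_adj.2 hadj, h02]
    push_cast
    linarith
  obtain ⟨h12, p, hp₁, hp₂⟩ := SimpleGraph.lineGraph_adj_iff_exists.1 hadj
  obtain ⟨q, hq⟩ := hp₁
  obtain ⟨r, hr⟩ := hp₂
  have hpq : G.Adj p q := by rw [← SimpleGraph.mem_edgeSet, ← hq]; exact e₁.2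
  have hpr : G.Adj p r := by rw [← SimpleGraph.mem_edgeSet, ← hr]; exact e₂.2
  obtain ⟨a, ha, ha0, ha1, ha2⟩ := exists_dist_increasing_of_lineGraph hconn hbip hpq.symm hpr
    (hq.trans Sym2.eq_swap) hr h01 h02
  obtain ⟨c, hc, hc0, hc1, hc2⟩ := exists_dist_increasing_of_lineGraph hconn hbip (e₀ := e₃)
    (e₁ := e₂) (e₂ := e₁) hpr.symm hpq (hr.trans Sym2.eq_swap) hq (Ne.symm h23)
    (by rw [SimpleGraph.dist_comm, h13, SimpleGraph.dist_comm, add_comm])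
  have hbow' := hbow.dist_add_dist_le hconn hpq.symm hpr ha1 ha2 hc2 hc1
  have hac : G.dist a c ≤ G.lineGraph.dist e₀ e₃ + 1 := by
    by_cases h03 : e₀ = e₃
    · subst h03
      have := dist_le_one_of_mem_edge e₀ ha hc
      omega
    · obtain ⟨a', ha', c', hc', h⟩ := exists_lineGraph_dist_eq hconn h03
      have t1 := dist_le_one_of_mem_edge e₀ ha ha'
      have t2 := dist_le_one_of_mem_edge e₃ hc' hc
      have t3 := hconn.dist_triangle (u := a) (v := a') (w := c)
      have t4 := hconn.dist_triangle (u := a') (v := c') (w := c)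
      omega
  have hac' : (G.dist a c : ℝ) ≤ G.lineGraph.dist e₀ e₃ + 1 := by exact_mod_cast hac
  rw [h13, ha0, SimpleGraph.dist_comm (u := e₂), hc0]
  push_cast
  linarith

end LineGraph

/-! ### Hyperbolicity -/

section Hyperbolic

variable {V : Type*} {G : SimpleGraph V} {μ : ℝ}

/-- If the predecessor `y` of `z` on a shortest path from `u` to `v` is farther from `w` than `z` is,
then `z` is within additive error `μ` of a shortest path from `w` to `u` or to `v`. The case of a
nearer predecessor is reduced to this one in `dist_add_dist_le_or_of_mem_interval`. -/
lemma dist_add_dist_le_or_of_adj (hconn : G.Connected) (hbip : G.IsBipartite) (hμ : 0 ≤ μ)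
    (hbow : SatisfiesBow G 1 μ) {u v w y z : V}
    (hz : G.dist u v = G.dist u z + G.dist z v) (hyz : G.Adj y z)
    (hu : G.dist u z = G.dist u y + 1) (hw : G.dist w y = G.dist w z + 1) :
    (G.dist u z : ℝ) + G.dist w z ≤ G.dist u w + μ ∨
      (G.dist v z : ℝ) + G.dist w z ≤ G.dist v w + μ := by
  rcases eq_or_ne z w with rfl | hzw
  · left; simp [hμ]
  rcases eq_or_ne z v with rfl | hzv
  · right; simp [hμ, SimpleGraph.dist_comm]
  by_cases hz' : ∃ z', G.Adj z z' ∧ G.dist w z = G.dist w z' + 1 ∧ G.dist u z' = G.dist u z + 1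
  · obtain ⟨z', hadj, hw', hu'⟩ := hz'
    exact .inl (hbow.dist_add_dist_le hconn hyz hadj hu hu' hw hw')
  right
  push Not at hz'
  obtain ⟨z', hadj, hw'⟩ := exists_adj_dist_eq_add_one hconn hzw
  obtain ⟨t, htz, hvt⟩ := exists_adj_dist_eq_add_one hconn hzv
  rw [SimpleGraph.dist_comm (u := z)] at hz
  -- The successor `t` of `z` on the path is farther from `u`, hence also farther from `w`.
  have hut : G.dist u t = G.dist u z + 1 := by
    have h := dist_eq_add_one_or_of_adj hconn hbip u htz
    have h' := hconn.dist_triangle (u := u) (v := t) (w := v)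
    rw [SimpleGraph.dist_comm (u := t)] at h'
    omega
  have hwt : G.dist w t = G.dist w z + 1 := by
    rcases dist_eq_add_one_or_of_adj hconn hbip w htz with h | h
    · exact absurd hut (hz' t htz.symm h)
    · exact h
  have huz' : G.dist u z = G.dist u z' + 1 := by
    rcases dist_eq_add_one_or_of_adj hconn hbip u hadj with h | h
    · exact h
    · exact absurd h (hz' z' hadj.symm hw')
  have hvz' : G.dist v z' = G.dist v z + 1 := by
    have h := dist_eq_add_one_or_of_adj hconn hbip v hadj
    have h' := hconn.dist_triangle (u := u) (v := z') (w := v)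
    rw [SimpleGraph.dist_comm (u := z')] at h'
    omega
  exact hbow.dist_add_dist_le hconn htz hadj.symm hvt hvz' hwt hw'

/-- A vertex on a shortest path from `u` to `v` is within additive error `μ + 2` of a shortest path
from `w` to `u` or of a shortest path from `w` to `v`. -/
lemma dist_add_dist_le_or_of_mem_interval (hconn : G.Connected) (hbip : G.IsBipartite)
    (hμ : 0 ≤ μ) (hbow : SatisfiesBow G 1 μ) {u v z : V} (w : V) (hz : z ∈ interval G u v) :
    (G.dist u z : ℝ) + G.dist w z ≤ G.dist u w + (μ + 2) ∨
      (G.dist v z : ℝ) + G.dist w z ≤ G.dist v w + (μ + 2) := by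
  simp only [interval, Set.mem_ofPred_eq] at hz
  rcases eq_or_ne z u with rfl | hzu
  · left
    rw [SimpleGraph.dist_self, SimpleGraph.dist_comm]
    push_cast
    linarith
  obtain ⟨y, hyz, huy⟩ := exists_adj_dist_eq_add_one hconn hzu
  rcases dist_eq_add_one_or_of_adj hconn hbip w hyz with h | h
  · -- Here `y` is nearer to `w` than its successor `z` is, and the path is read backwards.
    have hvy : G.dist v y = G.dist v z + 1 := by
      have h1 := dist_eq_add_one_or_of_adj hconn hbip v hyz
      have h2 := hconn.dist_triangle (u := u) (v := y) (w := v)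
      rw [SimpleGraph.dist_comm (u := y)] at h2
      rw [SimpleGraph.dist_comm (u := z)] at hz
      omega
    have hy : G.dist v u = G.dist v y + G.dist y u := by
      rw [SimpleGraph.dist_comm (v := u), SimpleGraph.dist_comm (v := u), hz,
        SimpleGraph.dist_comm (u := z)]
      omega
    rw [huy, h]
    rcases dist_add_dist_le_or_of_adj hconn hbip hμ hbow hy hyz.symm hvy h with h' | h'
    · right
      rw [hvy] at h'
      push_cast at h' ⊢
      linarith
    · left
      push_cast
      linarith
  · rcases dist_add_dist_le_or_of_adj hconn hbip hμ hbow hz hyz huy h with h' | h'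
    · left; linarith
    · right; linarith

theorem SatisfiesBow.isHyperbolic (hconn : G.Connected) (hbip : G.IsBipartite) (hμ : 0 ≤ μ)
    (hbow : SatisfiesBow G 1 μ) : IsHyperbolic G (μ + 3) := by
  intro u v w x
  by_contra! hlt
  obtain ⟨h1, h2⟩ : (G.dist u w : ℝ) + G.dist v x + 2 * (μ + 3) < G.dist u v + G.dist w x ∧
      (G.dist u x : ℝ) + G.dist v w + 2 * (μ + 3) < G.dist u v + G.dist w x := by
    rw [max_add, max_lt_iff] at hlt
    exact hlt
  have htri (z : V) : (G.dist w x : ℝ) ≤ G.dist w z + G.dist x z := by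
    rw [SimpleGraph.dist_comm (u := x)]
    exact_mod_cast hconn.dist_triangle
  -- Since the four-point condition fails, `z` stays close to shortest paths from `u` to both `w` and
  -- `x` all along the path: if one of them were left at `z`, then the estimate for `v` at `z` and that
  -- for the other vertex at the predecessor `y` of `z` would add up to the four-point condition.
  have key : ∀ (n : ℕ) (z : V), G.dist u z = n → z ∈ interval G u v →
      (G.dist u z : ℝ) + G.dist w z ≤ G.dist u w + (μ + 2) ∧
        (G.dist u z : ℝ) + G.dist x z ≤ G.dist u x + (μ + 2) := by
    intro n
    induction n with
    | zero =>
      intro z hn hz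
      obtain rfl : u = z := hconn.dist_eq_zero_iff.1 hn
      rw [SimpleGraph.dist_self, SimpleGraph.dist_comm (u := w), SimpleGraph.dist_comm (u := x)]
      constructor <;> push_cast <;> linarith
    | succ n ih =>
      intro z hn hz
      have hzu : z ≠ u := by rintro rfl; simp at hn
      have hw := dist_add_dist_le_or_of_mem_interval hconn hbip hμ hbow w hz
      have hx := dist_add_dist_le_or_of_mem_interval hconn hbip hμ hbow x hz
      obtain ⟨y, hyz, huy⟩ := exists_adj_dist_eq_add_one hconn hzu
      simp only [interval, Set.mem_ofPred_eq] at hz ih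
      rw [SimpleGraph.dist_comm (u := z)] at hz
      have hvy : G.dist v y = G.dist v z + 1 := by
        have h1 := dist_eq_add_one_or_of_adj hconn hbip v hyz
        have h2 := hconn.dist_triangle (u := u) (v := y) (w := v)
        rw [SimpleGraph.dist_comm (u := y)] at h2
        omega
      obtain ⟨hyw, hyx⟩ := ih y (by omega) (by rw [SimpleGraph.dist_comm (u := y)]; omega)
      have hstep (s : V) : (G.dist s y : ℝ) ≤ G.dist s z + 1 := by
        rcases dist_eq_add_one_or_of_adj hconn hbip s hyz with h | h
        · rw [h]; push_cast; linarith
        · rw [h]; push_cast; linarith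
      have hvy' : (G.dist v y : ℝ) = G.dist v z + 1 := by exact_mod_cast hvy
      have huy' : (G.dist u z : ℝ) = G.dist u y + 1 := by exact_mod_cast huy
      have hz' : (G.dist u v : ℝ) = G.dist u z + G.dist v z := by exact_mod_cast hz
      have t := htri y
      have sw := hstep w
      have sx := hstep x
      constructor
      · rcases hw with hw | hw
        · exact hw
        · linarith
      · rcases hx with hx | hx
        · exact hx
        · linarith
  obtain ⟨hv, -⟩ := key _ v rfl (by simp [interval])
  have t := htri v
  rw [SimpleGraph.dist_comm (u := x)] at t
  linarith

end Hyperbolic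

end BowMetric

theorem mainTheorem9 {V : Type*} [Finite V] (G : SimpleGraph V) (hconn : G.Connected)
    (hbip : G.IsBipartite) (μ : ℝ) (hμ : 0 ≤ μ) (hbow : BowMetric.SatisfiesBow G 1 μ) :
    BowMetric.IsAlphaMetric G.lineGraph (μ + 2) ∧
      ∃ δ : ℝ, δ ≤ 3 * (μ + 1) / 2 + 4 ∧ BowMetric.IsHyperbolic G δ :=
  ⟨hbow.isAlphaMetric_lineGraph hconn hbip hμ,
    μ + 3, by linarith, hbow.isHyperbolic hconn hbip hμ⟩
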